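/- Let $X$ be a complex Banach space. A *contraction semigroup* on $X$ is a family $T=\{T_t:t\ge 0\}$ of bounded operators with $T_{s+t}=T_sT_t$ and $\|T_t\|\le 1$ for $s,t\ge0$ and such that $t\mapsto T_tx$ is norm-continuous on $[0,\infty)$ for every $x\in X$ (so $T_0$ is an idempotent, not necessarily $\mathbf 1$). It is *locally finite* if for every $x\in X$ the norm-closure of the orbit $\{T_tx:t\ge0\}$ is compact. A *quasiautomorphism* is an operator $Q$ with $\|Q\|\le1$ whose restriction to its range $QX$ is an invertible isometry of $QX$ onto itself. A *semigroup of quasiautomorphisms* is a contraction semigroup $S$ such that every $S_t$, $t\ge0$, is a quasiautomorphism. For a contraction semigroup $T$ let $\sigma_p(T)$ be the set of all $\lambda\in\mathbb C$ for which there is a nonzero vector $x$ with $T_tx=e^{it\lambda}x$ for all $t\ge0$; such an $x$ is called an *eigenvector* of $T$, and it is called *maximal* if moreover $\|T_tx\|=\|x\|$ for all $t\ge0$. The *generator* of $T$ is the operator $Ax=\lim_{t\to0+}\frac1{it}(T_tx-x)$, defined for those $x$ for which the limit exists; it is *diagonalized* by a set $G$ if the elements of $G$ are eigenvectors of $A$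 and the closed linear span of $G$ is the whole space. The *set of strong limit points* of $T$ is $$\mathcal L=\bigcap_{\alpha>0}\overline{\{T_t:t\ge\alpha\}}^{\,\mathrm{strong}},$$ the closures being taken in the strong operator topology. **Theorem.** Let $T=\{T_t:t\ge0\}$ be a locally finite contraction semigroup on a complex Banach space $X$ with $T_0=\mathbf 1$. Then there is a unique semigroup $S=\{S_t:t\ge0\}$ of quasiautomorphisms such that $$\lim_{t\to\infty}\|T_tx-S_tx\|=0,\qquad x\in X.$$ Let $E=S_0$ and let $U_t$ be the restriction of $S_t$ to $EX$. Then: 1. $S_tX=EX$, $U_t$ is an invertible isometry of $EX$ onto itself, and $S_t=U_tE$ for all $t\ge0$. 2. The maximal eigenvectors of $U$ are exactly the maximal eigenvectors of $T$, and the generator of the semigroup $U$ on $EX$ is diagonalized by them; in particular $EX$ is their closed linear span. 3. The set of eigenvalues of the generator of $U$ is $\sigma_p(U)$, and $\sigma_p(U)=\sigma_p(T)\cap\mathbb R$. 4. $E$ is the unique idempotent in $\mathcal L$. 5. $U_t$ is the restriction of $T_t$ to $EX$, and $S_t=T_tE$, for all $t\ge0$. -/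

import Mathlib

open Filter Topology
open scoped NNReal

/-- A strongly continuous one-parameter semigroup `{T_t : t ≥ 0}` of contractions on a complex
normed space.  It is *not* required that `T_0 = 1`; in general `T_0` is an idempotent. -/
structure ContractionSemigroup (X : Type*) [NormedAddCommGroup X] [NormedSpace ℂ X] where
  /-- the operators `T_t` -/
  toFun : ℝ≥0 → X →L[ℂ] X
  map_add' : ∀ s t, toFun (s + t) = (toFun s).comp (toFun t)
  norm_le_one' : ∀ t, ‖toFun t‖ ≤ 1
  continuous' : ∀ x, Continuous fun t => toFun t x

/-- A quasiautomorphism: a contraction whose restriction to its range is an automorphism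
(i.e. a surjective linear isometry) of that range. -/
def IsQuasiautomorphism {X : Type*} [NormedAddCommGroup X] [NormedSpace ℂ X]
    (Q : X →L[ℂ] X) : Prop :=
  ‖Q‖ ≤ 1 ∧ ∃ V : Q.range ≃ₗᵢ[ℂ] Q.range, ∀ y : Q.range, (V y : X) = Q y

/-- The closure of a set of bounded operators in the strong operator topology. -/
def strongClosure {X : Type*} [NormedAddCommGroup X] [NormedSpace ℂ X]
    (A : Set (X →L[ℂ] X)) : Set (X →L[ℂ] X) :=
  (ContinuousLinearMap.toPointwiseConvergenceCLM ℂ (RingHom.id ℂ) X X) ⁻¹'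
    closure ((ContinuousLinearMap.toPointwiseConvergenceCLM ℂ (RingHom.id ℂ) X X) '' A)

/-- The set of eigenvalues of a (possibly unbounded) operator. -/
def LinearPMap.pointSpectrum {X : Type*} [NormedAddCommGroup X] [NormedSpace ℂ X]
    (A : X →ₗ.[ℂ] X) : Set ℂ :=
  {z | ∃ x : A.domain, x ≠ 0 ∧ A x = z • (x : X)}

/-- `A` is diagonalized by the set `G`: the elements of `G` are eigenvectors of `A`, and their
linear span is dense. -/
def LinearPMap.IsDiagonalizedBy {X : Type*} [NormedAddCommGroup X] [NormedSpace ℂ X]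
    (A : X →ₗ.[ℂ] X) (G : Set X) : Prop :=
  (∀ x ∈ G, x ≠ 0 ∧ ∃ hx : x ∈ A.domain, ∃ z : ℂ, A ⟨x, hx⟩ = z • x) ∧
    (Submodule.span ℂ G).topologicalClosure = ⊤

namespace ContractionSemigroup

variable {X : Type*} [NormedAddCommGroup X] [NormedSpace ℂ X]

instance : CoeFun (ContractionSemigroup X) fun _ => ℝ≥0 → X →L[ℂ] X := ⟨toFun⟩

/-- Every orbit is relatively norm-compact. -/
def IsLocallyFinite (T : ContractionSemigroup X) : Prop :=
  ∀ x, IsCompact (closure (Set.range fun t => T t x))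

/-- The set of strong limit points of `T_t` as `t → ∞`. -/
def strongLimitPoints (T : ContractionSemigroup X) : Set (X →L[ℂ] X) :=
  ⋂ (α : ℝ≥0) (_ : 0 < α), strongClosure (T.toFun '' Set.Ici α)

/-- `x` is a nonzero vector with `T_t x = e^{itz} x` for all `t ≥ 0`. -/
def IsEigenvector (T : ContractionSemigroup X) (z : ℂ) (x : X) : Prop :=
  x ≠ 0 ∧ ∀ t : ℝ≥0, T t x = Complex.exp (Complex.I * ((t : ℝ) : ℂ) * z) • x

/-- The point spectrum of the semigroup: all `z` for which `T_t x = e^{itz} x`, `t ≥ 0`, has a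
nonzero solution `x`. -/
def pointSpectrum (T : ContractionSemigroup X) : Set ℂ :=
  {z | ∃ x, T.IsEigenvector z x}

/-- The eigenvectors `x` of the semigroup with `‖T_t x‖ = ‖x‖` for all `t ≥ 0`. -/
def maximalEigenvectors (T : ContractionSemigroup X) : Set X :=
  {x | (∃ z, T.IsEigenvector z x) ∧ ∀ t, ‖T t x‖ = ‖x‖}

/-- `y` is the limit of `(it)⁻¹ (T_t x - x)` as `t → 0+`. -/
def HasGeneratorValue (T : ContractionSemigroup X) (x y : X) : Prop :=
  Tendsto (fun t : ℝ≥0 => (Complex.I * ((t : ℝ) : ℂ))⁻¹ • (T t x - x)) (𝓝[>] 0) (𝓝 y)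

theorem HasGeneratorValue.add {T : ContractionSemigroup X} {x y x' y' : X}
    (h : T.HasGeneratorValue x y) (h' : T.HasGeneratorValue x' y') :
    T.HasGeneratorValue (x + x') (y + y') := by
  unfold HasGeneratorValue at *
  refine (Tendsto.add h h').congr fun t => ?_
  rw [← smul_add, map_add]
  congr 1
  abel

theorem HasGeneratorValue.smul {T : ContractionSemigroup X} {x y : X} (c : ℂ)
    (h : T.HasGeneratorValue x y) : T.HasGeneratorValue (c • x) (c • y) := by
  unfold HasGeneratorValue at *
  refine (Tendsto.const_smul h c).congr fun t => ?_
  rw [smul_comm, map_smul, smul_sub]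

theorem HasGeneratorValue.unique {T : ContractionSemigroup X} {x y y' : X}
    (h : T.HasGeneratorValue x y) (h' : T.HasGeneratorValue x y') : y = y' :=
  tendsto_nhds_unique h h'

/-- The generator `A` of the semigroup, `A x = lim_{t → 0+} (it)⁻¹ (T_t x - x)` on the space of
all `x` for which this limit exists.  It is normalized so that formally `T_t = e^{itA}`, whence
`T_t x = e^{itz} x` for all `t` corresponds to `A x = z x`. -/
noncomputable def generator (T : ContractionSemigroup X) : X →ₗ.[ℂ] X where
  domain :=
    { carrier := {x | ∃ y, T.HasGeneratorValue x y}
      add_mem' := fun ⟨_, h⟩ ⟨_, h'⟩ => ⟨_, h.add h'⟩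
      zero_mem' := ⟨0, by simp [HasGeneratorValue]⟩
      smul_mem' := fun c _ ⟨_, h⟩ => ⟨_, h.smul c⟩ }
  toFun :=
    { toFun := fun x => Classical.choose x.2
      map_add' := fun x x' =>
        (Classical.choose_spec (x + x').2).unique
          ((Classical.choose_spec x.2).add (Classical.choose_spec x'.2))
      map_smul' := fun c x =>
        (Classical.choose_spec (c • x).2).unique ((Classical.choose_spec x.2).smul c) }

/-- The restrictions `U_t` of the operators `S_t` of a contraction semigroup to the range of the
idempotent `S_0` (which they leave invariant). -/
def onRange (S : ContractionSemigroup X) : ContractionSemigroup (S 0).range where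
  toFun t := (S t).restrict (p := (S 0).range) (q := (S 0).range) (by
    rintro _ ⟨x, rfl⟩
    refine ⟨S t x, ?_⟩
    have h : (S 0).comp (S t) = (S t).comp (S 0) := by
      rw [← S.map_add', ← S.map_add', add_comm]
    exact congrArg (fun L : X →L[ℂ] X => L x) h)
  map_add' s t := by
    ext y
    exact congrArg (fun L : X →L[ℂ] X => L y) (S.map_add' s t)
  norm_le_one' t := ContinuousLinearMap.opNorm_le_bound _ zero_le_one fun y => by
    have h := (S t).le_of_opNorm_le (S.norm_le_one' t) (y : X)
    exact h
  continuous' y := (S.continuous' y).subtype_mk _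

end ContractionSemigroup

/-!
The ultrafilters on `ℝ≥0` converging to infinity form a compact semigroup with one-sided continuous
addition, so there is an idempotent one, `u`. By local finiteness `T_t` converges strongly along
`u`, and the limit `E` is an idempotent. As `t ↦ ‖T_t x‖` is decreasing, every strong limit point of
`T` has the kernel `{x | T_t x → 0}`; strong limit points commute, so `E` is the only idempotent
among them. Hence `T_t (1 - E) → 0` strongly, and `S_t = T_t E` is the required semigroup.

On `EX` the operators `T_t` are isometric, and by compactness of the orbits also surjective, so they
extend to a one-parameter group of isometries with totally bounded orbits. The orbit pseudometric of
a vector `y` turns `ℝ` into a group with compact completion, and the orbit map of `y` extends to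
this completion. By the Peter–Weyl theorem `y` lies in the closed span of the common eigenvectors.
-/

open MeasureTheory InnerProductSpace

/-! ### The spectral theorem for compact abelian groups -/

/-- The simultaneous eigenvectors of a family of operators, together with `0`. The eigenvalue may
depend on the member of the family. -/
def commonEigenvectors (𝕜 : Type*) {ι F V : Type*} [SMul 𝕜 V] [FunLike F V V] (f : ι → F) :
    Set V :=
  {v | ∀ i, ∃ c : 𝕜, f i v = c • v}

theorem exists_ne_zero_mem_commonEigenvectors {K V ι : Type*} [Field K] [IsAlgClosed K]
    [AddCommGroup V] [Module K V] [FiniteDimensional K V] [Nontrivial V]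
    (f : ι → Module.End K V) (hf : ∀ i j, Commute (f i) (f j)) :
    ∃ v ∈ commonEigenvectors K f, v ≠ 0 := by
  induction hn : Module.finrank K V using Nat.strong_induction_on generalizing V with
  | _ n ih =>
    by_cases hscalar : ∀ i, ∃ c, Module.End.eigenspace (f i) c = ⊤
    · obtain ⟨v, hv⟩ := exists_ne (0 : V)
      refine ⟨v, fun i => (hscalar i).imp fun c hc => ?_, hv⟩
      exact Module.End.mem_eigenspace_iff.mp (hc ▸ Submodule.mem_top)
    · push Not at hscalar
      obtain ⟨i, hi⟩ := hscalar
      obtain ⟨c, hc⟩ := Module.End.exists_eigenvalue (f i)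
      have hmaps (j) : Set.MapsTo (f j) (Module.End.eigenspace (f i) c)
          (Module.End.eigenspace (f i) c) :=
        Module.End.mapsTo_genEigenspace_of_comm (hf i j) c 1
      have := Submodule.nontrivial_iff_ne_bot.mpr hc
      obtain ⟨v, hv, hv0⟩ := ih _ (hn ▸ Submodule.finrank_lt (hi c))
        (fun j => (f j).restrict (hmaps j))
        (fun j k => LinearMap.ext fun v => Subtype.ext (LinearMap.congr_fun (hf j k) v)) rfl
      exact ⟨v, fun j => (hv j).imp fun _ h => congrArg Subtype.val h,
        fun h => hv0 (Subtype.ext h)⟩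

theorem exists_ne_zero_mem_commonEigenvectors_of_isCompactOperator {H ι : Type*}
    [NormedAddCommGroup H] [InnerProductSpace ℂ H] [CompleteSpace H] {B : H →L[ℂ] H}
    (hcomp : IsCompactOperator B) (hsymm : B.IsSymmetric) (hB : B ≠ 0)
    (f : ι → Module.End ℂ H) (hf : ∀ i j, Commute (f i) (f j))
    (hBf : ∀ i, Commute (B : Module.End ℂ H) (f i)) :
    ∃ v ∈ commonEigenvectors ℂ f, v ≠ 0 := by
  obtain ⟨z, hz, hz0⟩ : ∃ z, Module.End.HasEigenvalue (B : Module.End ℂ H) z ∧ z ≠ 0 := by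
    by_contra! h
    exact hB ((ContinuousLinearMap.eq_zero_of_forall_hasEigenvalue_eq_zero hcomp hsymm).mp h)
  have := ContinuousLinearMap.finite_dimensional_eigenspace hcomp z hz0
  have := Submodule.nontrivial_iff_ne_bot.mpr hz
  obtain ⟨v, hv, hv0⟩ := exists_ne_zero_mem_commonEigenvectors
    (fun i => (f i).restrict (Module.End.mapsTo_genEigenspace_of_comm (hBf i) z 1))
    fun i j => LinearMap.ext fun v => Subtype.ext (LinearMap.congr_fun (hf i j) v)
  exact ⟨v, fun i => (hv i).imp fun _ h => congrArg Subtype.val h, fun h => hv0 (Subtype.ext h)⟩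

theorem span_commonEigenvectors_mem_invtSubmodule {K V ι F : Type*} [CommSemiring K]
    [AddCommMonoid V] [Module K V] [FunLike F V V] [LinearMapClass F K V V] (f : ι → F)
    {g : Module.End K V} (hfg : ∀ i v, f i (g v) = g (f i v)) :
    Submodule.span K (commonEigenvectors K f) ∈ Module.End.invtSubmodule g := by
  refine Submodule.span_le.mpr fun v hv => Submodule.subset_span fun i => ?_
  exact (hv i).imp fun c hc => by rw [hfg, hc, map_smul]

section FrameOperator

variable {α H : Type*} [TopologicalSpace α] [MeasurableSpace α] {μ : Measure α}
  [NormedAddCommGroup H] [InnerProductSpace ℂ H] {φ : α → H}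

variable (μ φ) in
/-- The frame operator `g ↦ ∫ ⟪φ a, g⟫ φ a dμ(a)` of a continuous family of vectors. -/
noncomputable def frameOperator : H →L[ℂ] H := ∫ a, rankOne ℂ (φ a) (φ a) ∂μ

variable [CompactSpace α] [OpensMeasurableSpace α] [IsFiniteMeasureOnCompacts μ]

theorem integrable_rankOne_self (hφ : Continuous φ) :
    Integrable (fun a => rankOne ℂ (φ a) (φ a)) μ := by
  have hcont : Continuous fun a => rankOne ℂ (φ a) (φ a) :=
    ((ContinuousLinearMap.smulRightL ℂ H H).continuous.comp
      ((innerSL ℂ (E := H)).continuous.comp hφ)).clm_apply hφ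
  exact hcont.integrable_of_hasCompactSupport (.of_compactSpace _)

theorem frameOperator_apply (hφ : Continuous φ) (g : H) :
    frameOperator μ φ g = ∫ a, inner ℂ (φ a) g • φ a ∂μ := by
  simpa only [frameOperator, rankOne_apply] using
    ContinuousLinearMap.integral_apply (integrable_rankOne_self (μ := μ) hφ) g

theorem isCompactOperator_frameOperator [CompleteSpace H] (hφ : Continuous φ) :
    IsCompactOperator (frameOperator μ φ) := by
  rcases eq_zero_or_neZero μ with rfl | _
  · rw [frameOperator, integral_zero_measure]
    exact isCompactOperator_zero
  have hconv : Convex ℝ {B : H →L[ℂ] H | IsCompactOperator B} :=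
    ((compactOperator (RingHom.id ℂ) H H).restrictScalars ℝ).convex
  rw [frameOperator, ← measure_smul_average]
  refine IsCompactOperator.smul (hconv.average_mem isClosed_setOfPred_isCompactOperator
    (Eventually.of_forall fun a => ?_) (integrable_rankOne_self hφ)) _
  exact (isCompactOperator_of_locallyCompactSpace_rng
    (ContinuousLinearMap.toSpanSingleton ℂ (φ a))).comp_clm (innerSL ℂ (φ a))

theorem inner_frameOperator_apply [CompleteSpace H] (hφ : Continuous φ) (h g : H) :
    inner ℂ h (frameOperator μ φ g) = ∫ a, inner ℂ (φ a) g * inner ℂ h (φ a) ∂μ := by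
  have hint : Integrable (fun a => inner ℂ (φ a) g • φ a) μ :=
    ((hφ.inner continuous_const).smul hφ).integrable_of_hasCompactSupport (.of_compactSpace _)
  rw [frameOperator_apply hφ, ← integral_inner hint]
  simp_rw [inner_smul_right]

theorem isSymmetric_frameOperator [CompleteSpace H] (hφ : Continuous φ) :
    (frameOperator μ φ).IsSymmetric := fun g h => by
  calc inner ℂ (frameOperator μ φ g) h
      = starRingEnd ℂ (∫ a, inner ℂ (φ a) g * inner ℂ h (φ a) ∂μ) := by
        rw [← inner_frameOperator_apply hφ, inner_conj_symm]
    _ = ∫ a, inner ℂ (φ a) h * inner ℂ g (φ a) ∂μ := by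
        simp only [← integral_conj, map_mul, inner_conj_symm, mul_comm]
    _ = inner ℂ g (frameOperator μ φ h) := (inner_frameOperator_apply hφ g h).symm

theorem inner_eq_zero_of_frameOperator_apply_eq_zero [CompleteSpace H] [μ.IsOpenPosMeasure]
    (hφ : Continuous φ) {g : H} (hg : frameOperator μ φ g = 0) (a : α) : inner ℂ (φ a) g = 0 := by
  have hsq (a : α) : inner ℂ (φ a) g * inner ℂ g (φ a) = ((‖inner ℂ (φ a) g‖ ^ 2 : ℝ) : ℂ) := by
    rw [← inner_conj_symm g, RCLike.mul_conj, Complex.ofReal_pow, RCLike.ofReal_eq_complex_ofReal]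
  have hint : ∫ a, ‖inner ℂ (φ a) g‖ ^ 2 ∂μ = 0 := by
    have h := inner_frameOperator_apply (μ := μ) hφ g g
    simp_rw [hg, inner_zero_right, hsq, integral_complex_ofReal] at h
    exact_mod_cast h.symm
  have hcont : Continuous fun a => ‖inner ℂ (φ a) g‖ ^ 2 := (hφ.inner continuous_const).norm.pow 2
  by_contra ha
  exact (hcont.integral_pos_of_hasCompactSupport_nonneg_nonzero (.of_compactSpace _)
    (fun a => by positivity) (x := a) (by simpa using ha)).ne' hint

theorem frameOperator_apply_map_of_forall_mul [CompleteSpace H] [Group α] [MeasurableMul α]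
    [μ.IsMulLeftInvariant] (hφ : Continuous φ) (V : H ≃ₗᵢ[ℂ] H) (s : α)
    (hV : ∀ a, φ (s * a) = V (φ a)) (g : H) :
    frameOperator μ φ (V g) = V (frameOperator μ φ g) := by
  have hint : Integrable (fun a => inner ℂ (φ a) g • φ a) μ :=
    ((hφ.inner continuous_const).smul hφ).integrable_of_hasCompactSupport (.of_compactSpace _)
  calc frameOperator μ φ (V g) = ∫ a, inner ℂ (φ (s * a)) (V g) • φ (s * a) ∂μ := by
        rw [frameOperator_apply hφ, integral_mul_left_eq_self fun a => inner ℂ (φ a) (V g) • φ a]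
    _ = ∫ a, V (inner ℂ (φ a) g • φ a) ∂μ := by
        simp only [hV, LinearIsometryEquiv.inner_map_map, map_smul]
    _ = V (frameOperator μ φ g) := by
        rw [frameOperator_apply hφ]
        exact V.toContinuousLinearEquiv.toContinuousLinearMap.integral_comp_comm hint

end FrameOperator

section CompactAbelianGroup

variable {G H : Type*} [CommGroup G] [NormedAddCommGroup H] [InnerProductSpace ℂ H]
  [CompleteSpace H]

theorem map_mem_orthogonal_span_commonEigenvectors (τ : G →* (H ≃ₗᵢ[ℂ] H)) (a : G) {g : H}
    (hg : g ∈ (Submodule.span ℂ (commonEigenvectors ℂ τ))ᗮ) :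
    τ a g ∈ (Submodule.span ℂ (commonEigenvectors ℂ τ))ᗮ := by
  have hadj : ContinuousLinearMap.adjoint (τ a : H →L[ℂ] H) = (τ a⁻¹ : H →L[ℂ] H) := by
    rw [LinearIsometryEquiv.adjoint_eq_symm, map_inv]
    rfl
  refine ContinuousLinearMap.orthogonal_mem_invtSubmodule (T := (τ a : H →L[ℂ] H)) ?_ hg
  rw [hadj]
  refine span_commonEigenvectors_mem_invtSubmodule τ fun b v => ?_
  change (τ b * τ a⁻¹) v = (τ a⁻¹ * τ b) v
  rw [← map_mul, ← map_mul, mul_comm]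

/-- If `f ≠ 0`, the frame operator of the orbit of `f` is compact, equivariant and nonzero on the
orthogonal complement of the common eigenvectors, which must then contain one of them. -/
theorem eq_zero_of_mem_orthogonal_span_commonEigenvectors [TopologicalSpace G]
    [IsTopologicalGroup G] [CompactSpace G] (τ : G →* (H ≃ₗᵢ[ℂ] H)) {f : H}
    (hcont : Continuous fun a => τ a f)
    (hf : f ∈ (Submodule.span ℂ (commonEigenvectors ℂ τ))ᗮ) : f = 0 := by
  borelize G
  let μ : Measure G := Measure.haarMeasure ⊤
  have : IsProbabilityMeasure μ := ⟨by simpa using Measure.haarMeasure_self (G := G) (K₀ := ⊤)⟩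
  let B := frameOperator μ fun a => τ a f
  have hBτ (s : G) (g : H) : B (τ s g) = τ s (B g) :=
    frameOperator_apply_map_of_forall_mul hcont (τ s) s (fun a => by rw [map_mul]; rfl) g
  have hsymm : B.IsSymmetric := isSymmetric_frameOperator hcont
  let N := (Submodule.span ℂ (commonEigenvectors ℂ τ))ᗮ
  have hBN : ∀ g ∈ N, B g ∈ N := hsymm.orthogonalComplement_mem_invtSubmodule
    (span_commonEigenvectors_mem_invtSubmodule τ fun s g => (hBτ s g).symm)
  have hBN0 : B.restrict hBN = 0 := by
    by_contra hne
    obtain ⟨v, hv, hv0⟩ := exists_ne_zero_mem_commonEigenvectors_of_isCompactOperator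
      ((isCompactOperator_frameOperator hcont).restrict' hBN) (hsymm.restrict_invariant hBN) hne
      (fun a => (τ a).toLinearEquiv.toLinearMap.restrict
        fun _ => map_mem_orthogonal_span_commonEigenvectors τ a)
      (fun a b => LinearMap.ext fun v => Subtype.ext <|
        show (τ a * τ b) (v : H) = (τ b * τ a) v by rw [← map_mul, ← map_mul, mul_comm])
      (fun a => LinearMap.ext fun v => Subtype.ext (hBτ a v))
    have hv' : (v : H) ∈ commonEigenvectors ℂ τ := fun a =>
      (hv a).imp fun c hc => congrArg Subtype.val hc
    exact hv0 (Subtype.ext (inner_self_eq_zero.mp (v.2 v (Submodule.subset_span hv'))))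
  have hBf : B f = 0 := congrArg Subtype.val (DFunLike.congr_fun hBN0 (⟨f, hf⟩ : N))
  have hff := inner_eq_zero_of_frameOperator_apply_eq_zero hcont hBf 1
  rwa [map_one, LinearIsometryEquiv.coe_one, id_eq, inner_self_eq_zero] at hff

end CompactAbelianGroup

section Translation

variable {G : Type*} [CommGroup G] [MeasurableSpace G] [MeasurableMul G]

/-- Translation `f ↦ f (a * ·)` on `Lᵖ` of an abelian group. -/
noncomputable def translationLp (E : Type*) [NormedAddCommGroup E] [NormedSpace ℂ E]
    (p : ENNReal) [Fact (1 ≤ p)] (μ : Measure G) [μ.IsMulLeftInvariant] :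
    G →* (Lp E p μ ≃ₗᵢ[ℂ] Lp E p μ) where
  toFun a :=
    { DistribMulAction.toLinearEquiv ℂ (Lp E p μ) (DomMulAct.mk a) with
      norm_map' := DomMulAct.norm_smul_Lp _ }
  map_one' := LinearIsometryEquiv.ext (one_smul Gᵈᵐᵃ)
  map_mul' a b := LinearIsometryEquiv.ext fun f => by
    rw [mul_comm]
    exact mul_smul (DomMulAct.mk a) (DomMulAct.mk b) f

theorem coeFn_translationLp {E : Type*} [NormedAddCommGroup E] [NormedSpace ℂ E]
    {p : ENNReal} [Fact (1 ≤ p)] {μ : Measure G} [μ.IsMulLeftInvariant] (a : G) (f : Lp E p μ) :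
    translationLp E p μ a f =ᵐ[μ] fun x => f (a * x) :=
  DomMulAct.smul_Lp_ae_eq (DomMulAct.mk a) f

end Translation

theorem mem_topologicalClosure_of_forall_dual_apply_eq_zero {𝕜 Y : Type*} [RCLike 𝕜]
    [SeminormedAddCommGroup Y] [NormedSpace 𝕜 Y] {M : Submodule 𝕜 Y} {y : Y}
    (h : ∀ φ : StrongDual 𝕜 Y, (∀ v ∈ M, φ v = 0) → φ y = 0) : y ∈ M.topologicalClosure := by
  have : IsClosed (M.topologicalClosure : Set Y) := M.isClosed_topologicalClosure
  by_contra hy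
  obtain ⟨ψ, hψ⟩ := SeparatingDual.exists_ne_zero (R := 𝕜)
    ((Submodule.Quotient.mk_eq_zero M.topologicalClosure).not.mpr hy)
  refine hψ (h (ψ.comp M.topologicalClosure.mkQL) fun v hv => ?_)
  change ψ (Submodule.Quotient.mk v) = 0
  rw [(Submodule.Quotient.mk_eq_zero _).mpr (M.le_topologicalClosure hv), map_zero]

theorem integrable_conj_smul {G Y : Type*} [TopologicalSpace G] [CompactSpace G]
    [MeasurableSpace G] [OpensMeasurableSpace G] {μ : Measure G} [IsFiniteMeasure μ]
    [NormedAddCommGroup Y] [NormedSpace ℂ Y] {Φ : G → Y} (hΦ : Continuous Φ) (h : Lp ℂ 2 μ) :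
    Integrable (fun x => starRingEnd ℂ (h x) • Φ x) μ := by
  have hconj : Integrable (fun x => starRingEnd ℂ (h x)) μ :=
    (Lp.memLp h).star.integrable one_le_two
  obtain ⟨C, hC⟩ := (isCompact_range hΦ).isBounded.exists_norm_le
  exact hconj.smul_bdd C
    (hΦ.stronglyMeasurable_of_hasCompactSupport (.of_compactSpace Φ)).aestronglyMeasurable
    (Eventually.of_forall fun x => hC _ (Set.mem_range_self x))

section EquivariantMap

variable {G A Y : Type*} [CommGroup G] [TopologicalSpace G] [IsTopologicalGroup G] [CompactSpace G]
  [NormedAddCommGroup Y] [NormedSpace ℂ Y] [CompleteSpace Y] {ρ : A → Y →L[ℂ] Y} {e : A → G}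
  {Φ : G → Y}

theorem integral_conj_smul_mem_commonEigenvectors [MeasurableSpace G] [BorelSpace G]
    {μ : Measure G} [IsFiniteMeasure μ] [μ.IsMulLeftInvariant] (hΦ : Continuous Φ)
    (hρ : ∀ a g, Φ (e a * g) = ρ a (Φ g)) {h : Lp ℂ 2 μ}
    (hh : h ∈ commonEigenvectors ℂ (translationLp ℂ 2 μ)) :
    ∫ x, starRingEnd ℂ (h x) • Φ x ∂μ ∈ commonEigenvectors ℂ ρ := fun a => by
  obtain ⟨c, hc⟩ := hh (e a)⁻¹
  have hce : (fun x => h ((e a)⁻¹ * x)) =ᵐ[μ] fun x => c • h x :=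
    (coeFn_translationLp (e a)⁻¹ h).symm.trans (hc ▸ Lp.coeFn_smul c h)
  refine ⟨starRingEnd ℂ c, ?_⟩
  calc ρ a (∫ x, starRingEnd ℂ (h x) • Φ x ∂μ)
      = ∫ x, starRingEnd ℂ (h x) • Φ (e a * x) ∂μ := by
        rw [← (ρ a).integral_comp_comm (integrable_conj_smul hΦ h)]
        simp only [map_smul, hρ]
    _ = ∫ x, starRingEnd ℂ (h ((e a)⁻¹ * x)) • Φ x ∂μ := by
        rw [← integral_mul_left_eq_self _ (e a)⁻¹]
        simp only [mul_inv_cancel_left]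
    _ = ∫ x, starRingEnd ℂ c • starRingEnd ℂ (h x) • Φ x ∂μ := by
        refine integral_congr_ae (hce.mono fun x hx => ?_)
        simp only [hx, smul_eq_mul, map_mul, mul_smul]
    _ = starRingEnd ℂ c • ∫ x, starRingEnd ℂ (h x) • Φ x ∂μ := integral_smul _ _

theorem mem_closure_span_commonEigenvectors_of_equivariant (hΦ : Continuous Φ)
    (hρ : ∀ a g, Φ (e a * g) = ρ a (Φ g)) (g : G) :
    Φ g ∈ (Submodule.span ℂ (commonEigenvectors ℂ ρ)).topologicalClosure := by
  borelize G
  let μ : Measure G := Measure.haarMeasure ⊤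
  have : IsProbabilityMeasure μ := ⟨by simpa using Measure.haarMeasure_self (G := G) (K₀ := ⊤)⟩
  have : Fact ((2 : ENNReal) ≠ ⊤) := ⟨ENNReal.ofNat_ne_top⟩
  refine mem_topologicalClosure_of_forall_dual_apply_eq_zero fun φ hφ => ?_
  let F : C(G, ℂ) := ⟨φ ∘ Φ, φ.continuous.comp hΦ⟩
  let f : Lp ℂ 2 μ := ContinuousMap.toLp 2 μ ℂ F
  have hinner (h : Lp ℂ 2 μ) : inner ℂ h f = φ (∫ x, starRingEnd ℂ (h x) • Φ x ∂μ) := by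
    rw [L2.inner_def, ← φ.integral_comp_comm (integrable_conj_smul hΦ h)]
    refine integral_congr_ae ?_
    filter_upwards [ContinuousMap.coeFn_toLp (p := 2) (𝕜 := ℂ) μ F] with x hx
    rw [hx, RCLike.inner_apply, map_smul, smul_eq_mul, mul_comm]
    rfl
  have hf : f = 0 := by
    refine eq_zero_of_mem_orthogonal_span_commonEigenvectors (translationLp ℂ 2 μ)
      (DomMulAct.continuous_mk.smul continuous_const) fun u hu => ?_
    refine Submodule.mem_orthogonal_singleton_iff_inner_left.mp
      (Submodule.span_le.mpr (fun h hh => ?_) hu)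
    rw [SetLike.mem_coe, Submodule.mem_orthogonal_singleton_iff_inner_left, hinner]
    exact hφ _ (Submodule.subset_span (integral_conj_smul_mem_commonEigenvectors hΦ hρ hh))
  have hF : F = 0 := ContinuousMap.toLp_injective (p := 2) (𝕜 := ℂ) μ (hf.trans (map_zero _).symm)
  exact DFunLike.congr_fun hF g

end EquivariantMap

theorem compactSpace_completion_of_totallyBounded_univ {α : Type*} [UniformSpace α]
    (h : TotallyBounded (Set.univ : Set α)) : CompactSpace (UniformSpace.Completion α) := by
  have hrange := (h.image (UniformSpace.Completion.uniformContinuous_coe α)).closure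
  rw [Set.image_univ, UniformSpace.Completion.denseRange_coe.closure_range] at hrange
  exact isCompact_univ_iff.mp (hrange.isCompact_of_isClosed isClosed_univ)

/-- The pseudometric `dist (ρ a y) (ρ b y)` on `A` is translation invariant and totally bounded, so
the completion of `A` is a compact group. -/
theorem mem_closure_span_commonEigenvectors_of_totallyBounded {A Y : Type*} [AddCommGroup A]
    [NormedAddCommGroup Y] [NormedSpace ℂ Y] [CompleteSpace Y]
    (ρ : Multiplicative A →* (Y ≃ₗᵢ[ℂ] Y)) {y : Y}
    (hy : TotallyBounded (Set.range fun a => ρ a y)) :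
    y ∈ (Submodule.span ℂ (commonEigenvectors ℂ ρ)).topologicalClosure := by
  let orbit : A → Y := fun a => ρ (.ofAdd a) y
  have horbit_add (a b : A) : orbit (a + b) = ρ (.ofAdd a) (orbit b) := by
    simp only [orbit, ofAdd_add, map_mul]
    rfl
  have horbit_zero : orbit 0 = y := by simp [orbit]
  let : PseudoMetricSpace A := .induced orbit inferInstance
  let : Norm A := ⟨fun a => dist 0 a⟩
  let : SeminormedAddCommGroup A := .ofAddDist (fun _ => rfl) fun a b c => by
    change dist (orbit a) (orbit b) ≤ dist (orbit (c + a)) (orbit (c + b))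
    rw [horbit_add, horbit_add, LinearIsometryEquiv.dist_map]
  have hiso : Isometry orbit := .of_dist_eq fun _ _ => rfl
  have hbdd : TotallyBounded (Set.univ : Set A) := by
    rw [← Set.preimage_range orbit]
    exact totallyBounded_preimage hiso.isUniformInducing hy
  have := compactSpace_completion_of_totallyBounded_univ hbdd
  let Φ : Multiplicative (UniformSpace.Completion A) → Y :=
    fun g => UniformSpace.Completion.extension orbit g.toAdd
  have hΦ : Continuous Φ := UniformSpace.Completion.continuous_extension.comp continuous_toAdd
  have hΦ_coe (a : A) : Φ (.ofAdd a) = orbit a :=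
    UniformSpace.Completion.extension_coe hiso.uniformContinuous a
  have hequiv (a : Multiplicative A) (g) :
      Φ (.ofAdd (a.toAdd : UniformSpace.Completion A) * g) = ρ a (Φ g) := by
    induction g using Multiplicative.rec with | ofAdd g => _
    induction g using UniformSpace.Completion.induction_on with
    | hp =>
      exact isClosed_eq (hΦ.comp (by fun_prop)) ((ρ a).continuous.comp (hΦ.comp (by fun_prop)))
    | ih b => rw [← ofAdd_add, ← UniformSpace.Completion.coe_add, hΦ_coe, hΦ_coe, horbit_add]; rfl
  rw [← horbit_zero, ← hΦ_coe]
  exact mem_closure_span_commonEigenvectors_of_equivariant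
    (ρ := fun a => (ρ a : Y →L[ℂ] Y)) hΦ hequiv _

/-! ### Strong limit points -/

theorem exists_ultrafilter_le_atTop_forall_eventually_add_iff {M : Type*} [AddSemigroup M]
    [Preorder M] [CanonicallyOrderedAdd M] [IsDirectedOrder M] [Nonempty M] :
    ∃ u : Ultrafilter M, ↑u ≤ (atTop : Filter M) ∧
      ∀ p : M → Prop, (∀ᶠ s in u, ∀ᶠ t in u, p (s + t)) ↔ ∀ᶠ t in u, p t := by
  let := Ultrafilter.addSemigroup (M := M)
  have hclosed : IsClosed {u : Ultrafilter M | ↑u ≤ (atTop : Filter M)} := by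
    simp only [atTop, le_iInf_iff, le_principal_iff, Set.ofPred_forall]
    exact isClosed_iInter fun c => ultrafilter_isClosed_basic (Set.Ici c)
  obtain ⟨u, hu, huu⟩ := exists_idempotent_in_compact_add_subsemigroup
    Ultrafilter.continuous_add_left {u : Ultrafilter M | ↑u ≤ (atTop : Filter M)}
    ⟨Ultrafilter.of atTop, Ultrafilter.of_le _⟩ hclosed.isCompact fun u hu v _ =>
      tendsto_atTop.mpr fun c => (Ultrafilter.eventually_add u v (c ≤ ·)).mpr
        ((tendsto_atTop.mp hu c).mono fun s hs =>
          Eventually.of_forall fun t => le_add_of_le_left hs)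
  exact ⟨u, hu, fun p => by rw [← Ultrafilter.eventually_add u u p, huu]⟩

theorem exists_tendsto_ultrafilter_of_forall_isCompact_closure_range {𝕜 ι V W : Type*}
    [NontriviallyNormedField 𝕜] [NormedAddCommGroup V] [NormedSpace 𝕜 V] [NormedAddCommGroup W]
    [NormedSpace 𝕜 W] (u : Ultrafilter ι) (f : ι → V →L[𝕜] W)
    (hf : Bornology.IsBounded (Set.range f))
    (hcomp : ∀ x, IsCompact (closure (Set.range fun i => f i x))) :
    ∃ P : V →L[𝕜] W, ∀ x, Tendsto (fun i => f i x) u (𝓝 (P x)) := by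
  have hlim (x : V) : ∃ y, Tendsto (fun i => f i x) u (𝓝 y) := by
    obtain ⟨y, -, hy⟩ := (hcomp x).ultrafilter_le_nhds (u.map fun i => f i x)
      (le_principal_iff.mpr (Filter.mem_map.mpr
        (Eventually.of_forall fun i => subset_closure (Set.mem_range_self i))))
    exact ⟨y, hy⟩
  choose P hP using hlim
  exact ⟨.ofTendstoOfBoundedRange P f (tendsto_pi_nhds.mpr hP) hf, hP⟩

theorem eq_of_isIdempotentElem_of_commute_of_ker_eq {K V : Type*} [Ring K] [AddCommGroup V]
    [Module K V] [TopologicalSpace V] {E F : V →L[K] V} (hE : IsIdempotentElem E)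
    (hF : IsIdempotentElem F) (hcomm : Commute E F) (hker : ∀ x, E x = 0 ↔ F x = 0) : E = F := by
  have hE2 (x : V) : E (E x) = E x := DFunLike.congr_fun hE x
  have hF2 (x : V) : F (F x) = F x := DFunLike.congr_fun hF x
  ext x
  have hEF : E x = E (F x) := by
    rw [← sub_eq_zero, ← map_sub, hker, map_sub, hF2, sub_self]
  have hFE : F x = F (E x) := by
    rw [← sub_eq_zero, ← map_sub, ← hker, map_sub, hE2, sub_self]
  calc E x = E (F x) := hEF
    _ = F (E x) := DFunLike.congr_fun hcomm.eq x
    _ = F x := hFE.symm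

theorem tendsto_toPointwiseConvergenceCLM_iff {ι X : Type*} [NormedAddCommGroup X]
    [NormedSpace ℂ X] {l : Filter ι} {f : ι → X →L[ℂ] X} {P : X →L[ℂ] X} :
    Tendsto (fun i => ContinuousLinearMap.toPointwiseConvergenceCLM ℂ (RingHom.id ℂ) X X (f i)) l
      (𝓝 (ContinuousLinearMap.toPointwiseConvergenceCLM ℂ (RingHom.id ℂ) X X P)) ↔
    ∀ x, Tendsto (fun i => f i x) l (𝓝 (P x)) := by
  rw [(PointwiseConvergenceCLM.isEmbedding_coeFn (RingHom.id ℂ) X X).tendsto_nhds_iff,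
    tendsto_pi_nhds]
  rfl

namespace ContractionSemigroup

variable {X : Type*} [NormedAddCommGroup X] [NormedSpace ℂ X]

section Basic

variable (T : ContractionSemigroup X)

theorem add_apply (s t : ℝ≥0) (x : X) : T (s + t) x = T s (T t x) := by
  rw [T.map_add']
  rfl

theorem apply_comm (s t : ℝ≥0) (x : X) : T s (T t x) = T t (T s x) := by
  rw [← T.add_apply, ← T.add_apply, add_comm]

theorem zero_apply_apply (t : ℝ≥0) (x : X) : T 0 (T t x) = T t x := by
  rw [← T.add_apply, zero_add]

theorem apply_zero_apply (t : ℝ≥0) (x : X) : T t (T 0 x) = T t x := by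
  rw [← T.add_apply, add_zero]

theorem isIdempotentElem_zero : IsIdempotentElem (T 0) :=
  ContinuousLinearMap.ext (T.zero_apply_apply 0)

theorem norm_apply_le (t : ℝ≥0) (x : X) : ‖T t x‖ ≤ ‖x‖ := by
  simpa only [one_mul] using (T t).le_of_opNorm_le (T.norm_le_one' t) x

theorem antitone_norm_apply (x : X) : Antitone fun t => ‖T t x‖ := fun s t hst =>
  calc ‖T t x‖ = ‖T (t - s) (T s x)‖ := by rw [← T.add_apply, tsub_add_cancel_of_le hst]
    _ ≤ ‖T s x‖ := T.norm_apply_le _ _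

theorem isBounded_range : Bornology.IsBounded (Set.range T.toFun) :=
  isBounded_iff_forall_norm_le.mpr ⟨1, Set.forall_mem_range.mpr T.norm_le_one'⟩

theorem antitone_range : Antitone fun t => (T t).range := by
  rintro s t hst _ ⟨x, rfl⟩
  exact ⟨T (t - s) x, by rw [ContinuousLinearMap.coe_coe, ContinuousLinearMap.coe_coe,
    ← T.add_apply, add_tsub_cancel_of_le hst]⟩

end Basic

variable {T S : ContractionSemigroup X} {E F : X →L[ℂ] X}

section StrongLimitPoints

theorem mem_strongLimitPoints_iff : F ∈ T.strongLimitPoints ↔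
    ∃ u : Ultrafilter ℝ≥0, ↑u ≤ (atTop : Filter ℝ≥0) ∧
      ∀ x, Tendsto (fun t => T t x) u (𝓝 (F x)) := by
  let p := ContinuousLinearMap.toPointwiseConvergenceCLM ℂ (RingHom.id ℂ) X X
  have hcluster : F ∈ T.strongLimitPoints ↔ MapClusterPt (p F) atTop fun t => p (T t) := by
    simp only [mapClusterPt_atTop_iff_forall_mem_closure, strongLimitPoints, strongClosure,
      Set.mem_iInter, Set.mem_preimage, Set.image_image]
    refine ⟨fun h α => ?_, fun h α _ => h α⟩
    exact closure_mono (Set.image_mono (Set.Ici_subset_Ici.mpr le_self_add))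
      (h (α + 1) (by positivity))
  rw [hcluster, mapClusterPt_iff_ultrafilter]
  simp only [p, tendsto_toPointwiseConvergenceCLM_iff]

theorem norm_le_one_of_mem_strongLimitPoints (hF : F ∈ T.strongLimitPoints) : ‖F‖ ≤ 1 := by
  obtain ⟨u, -, hu⟩ := mem_strongLimitPoints_iff.mp hF
  refine F.opNorm_le_bound zero_le_one fun x => ?_
  rw [one_mul]
  exact le_of_tendsto (hu x).norm (Eventually.of_forall fun t => T.norm_apply_le t x)

theorem commute_of_mem_strongLimitPoints {B : X →L[ℂ] X} (hF : F ∈ T.strongLimitPoints)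
    (hB : ∀ t, Commute B (T t)) : Commute B F := by
  obtain ⟨u, -, hu⟩ := mem_strongLimitPoints_iff.mp hF
  ext x
  exact tendsto_nhds_unique (((B.continuous.tendsto _).comp (hu x)).congr fun t =>
    DFunLike.congr_fun (hB t).eq x) (hu (B x))

theorem commute_apply_of_mem_strongLimitPoints (hF : F ∈ T.strongLimitPoints) (t : ℝ≥0) :
    Commute (T t) F :=
  commute_of_mem_strongLimitPoints hF fun s => ContinuousLinearMap.ext (T.apply_comm t s)

theorem apply_comm_of_mem_strongLimitPoints (hF : F ∈ T.strongLimitPoints) (t : ℝ≥0) (x : X) :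
    T t (F x) = F (T t x) :=
  DFunLike.congr_fun (commute_apply_of_mem_strongLimitPoints hF t).eq x

theorem zero_apply_of_mem_strongLimitPoints (hF : F ∈ T.strongLimitPoints) (x : X) :
    T 0 (F x) = F x := by
  obtain ⟨u, -, hu⟩ := mem_strongLimitPoints_iff.mp hF
  exact tendsto_nhds_unique (((T 0).continuous.tendsto _).comp (hu x))
    ((hu x).congr fun t => (T.zero_apply_apply t x).symm)

theorem apply_eq_zero_iff_tendsto (hF : F ∈ T.strongLimitPoints) {x : X} :
    F x = 0 ↔ Tendsto (fun t => T t x) atTop (𝓝 0) := by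
  obtain ⟨u, hu, hF⟩ := mem_strongLimitPoints_iff.mp hF
  refine ⟨fun h => Metric.tendsto_atTop.mpr fun ε hε => ?_,
    fun h => tendsto_nhds_unique (hF x) (h.mono_left hu)⟩
  obtain ⟨t, ht⟩ := (Metric.tendsto_nhds.mp (h ▸ hF x) ε hε).exists
  refine ⟨t, fun s hs => ?_⟩
  rw [dist_zero_right] at ht ⊢
  exact (T.antitone_norm_apply x hs).trans_lt ht

theorem tendsto_apply_sub_of_mem_strongLimitPoints (hE : E ∈ T.strongLimitPoints)
    (hidem : IsIdempotentElem E) (x : X) : Tendsto (fun t => T t (x - E x)) atTop (𝓝 0) := by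
  rw [← apply_eq_zero_iff_tendsto hE, map_sub, sub_eq_zero]
  exact (DFunLike.congr_fun hidem.eq x).symm

theorem norm_apply_eq_of_mem_strongLimitPoints (hF : F ∈ T.strongLimitPoints)
    {x : X} (hx : F x = x) (t : ℝ≥0) : ‖T t x‖ = ‖x‖ := by
  obtain ⟨u, hu, hF⟩ := mem_strongLimitPoints_iff.mp hF
  refine le_antisymm (T.norm_apply_le t x) (le_of_tendsto (hx ▸ (hF x).norm) ?_)
  filter_upwards [hu (eventually_ge_atTop t)] with s hs
  exact T.antitone_norm_apply x hs

theorem eq_of_isIdempotentElem_of_mem_strongLimitPoints (hE : E ∈ T.strongLimitPoints)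
    (hF : F ∈ T.strongLimitPoints) (hE2 : IsIdempotentElem E) (hF2 : IsIdempotentElem F) :
    E = F :=
  eq_of_isIdempotentElem_of_commute_of_ker_eq hE2 hF2
    (commute_of_mem_strongLimitPoints hF fun t =>
      (commute_apply_of_mem_strongLimitPoints hE t).symm)
    fun x => by rw [apply_eq_zero_iff_tendsto hE, apply_eq_zero_iff_tendsto hF]

theorem IsLocallyFinite.exists_isIdempotentElem_mem_strongLimitPoints (hT : T.IsLocallyFinite) :
    ∃ E ∈ T.strongLimitPoints, IsIdempotentElem E := by
  obtain ⟨u, hu, hadd⟩ := exists_ultrafilter_le_atTop_forall_eventually_add_iff (M := ℝ≥0)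
  obtain ⟨E, hE⟩ := exists_tendsto_ultrafilter_of_forall_isCompact_closure_range u T.toFun
    T.isBounded_range hT
  refine ⟨E, mem_strongLimitPoints_iff.mpr ⟨u, hu, hE⟩, ?_⟩
  ext x
  refine tendsto_nhds_unique (hE (E x)) (Metric.tendsto_nhds.mpr fun ε hε => ?_)
  have hclose : ∀ᶠ s in (u : Filter ℝ≥0), ∀ᶠ t in (u : Filter ℝ≥0),
      dist (T (s + t) x) (E x) < ε / 2 :=
    (hadd _).mpr (Metric.tendsto_nhds.mp (hE x) _ (half_pos hε))
  filter_upwards [hclose] with s hs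
  have hlim : Tendsto (fun t => T (s + t) x) u (𝓝 (T s (E x))) :=
    (((T s).continuous.tendsto _).comp (hE x)).congr fun t => (T.add_apply s t x).symm
  calc dist (T s (E x)) (E x) ≤ ε / 2 :=
        le_of_tendsto (hlim.dist tendsto_const_nhds) (hs.mono fun t ht => ht.le)
    _ < ε := half_lt_self hε

theorem IsLocallyFinite.exists_apply_eq (hT : T.IsLocallyFinite) (hE : E ∈ T.strongLimitPoints)
    {x : X} (hx : E x = x) (t : ℝ≥0) : ∃ z, E z = z ∧ T t z = x := by
  obtain ⟨u, hu, hEu⟩ := mem_strongLimitPoints_iff.mp hE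
  obtain ⟨z, -, hz⟩ := (hT x).ultrafilter_le_nhds (u.map fun r => T (r - t) x)
    (le_principal_iff.mpr (Filter.mem_map.mpr
      (Eventually.of_forall fun r => subset_closure (Set.mem_range_self _))))
  refine ⟨z, tendsto_nhds_unique (((E.continuous.tendsto z).comp hz).congr fun r => ?_) hz,
    tendsto_nhds_unique (((T t).continuous.tendsto z).comp hz) ((hx ▸ hEu x).congr' ?_)⟩
  · rw [Function.comp_apply, ← apply_comm_of_mem_strongLimitPoints hE, hx]
  · filter_upwards [hu (eventually_ge_atTop t)] with r hr
    rw [Function.comp_apply, ← T.add_apply, add_tsub_cancel_of_le hr]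

end StrongLimitPoints

end ContractionSemigroup

/-! ### Semigroups of quasiautomorphisms -/

namespace IsQuasiautomorphism

variable {X : Type*} [NormedAddCommGroup X] [NormedSpace ℂ X] {Q : X →L[ℂ] X}

theorem of_norm_apply_apply (hQ : ‖Q‖ ≤ 1) (hiso : ∀ x, ‖Q (Q x)‖ = ‖Q x‖)
    (hsurj : ∀ x, ∃ z, Q (Q z) = Q x) : IsQuasiautomorphism Q := by
  let L : Q.range →ₗᵢ[ℂ] Q.range :=
    { toLinearMap := (Q : X →ₗ[ℂ] X).restrict fun x _ => ⟨x, rfl⟩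
      norm_map' := by
        rintro ⟨_, x, rfl⟩
        exact hiso x }
  refine ⟨hQ, LinearIsometryEquiv.ofSurjective L ?_, fun y => rfl⟩
  rintro ⟨_, x, rfl⟩
  obtain ⟨z, hz⟩ := hsurj x
  exact ⟨⟨Q z, z, rfl⟩, Subtype.ext hz⟩

theorem norm_apply_apply (hQ : IsQuasiautomorphism Q) (x : X) : ‖Q (Q x)‖ = ‖Q x‖ := by
  obtain ⟨-, V, hV⟩ := hQ
  calc ‖Q (Q x)‖ = ‖V ⟨Q x, x, rfl⟩‖ := congrArg norm (hV ⟨Q x, x, rfl⟩).symm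
    _ = ‖Q x‖ := V.norm_map _

theorem exists_apply_apply_eq (hQ : IsQuasiautomorphism Q) (x : X) : ∃ z, Q (Q z) = Q x := by
  obtain ⟨-, V, hV⟩ := hQ
  obtain ⟨⟨_, z, rfl⟩, hz⟩ := V.surjective ⟨Q x, x, rfl⟩
  exact ⟨z, (hV _).symm.trans (congrArg Subtype.val hz)⟩

end IsQuasiautomorphism

namespace ContractionSemigroup

variable {X : Type*} [NormedAddCommGroup X] [NormedSpace ℂ X] {T S : ContractionSemigroup X}
  {E : X →L[ℂ] X}

section Quasiautomorphism

theorem range_le_range_of_isQuasiautomorphism (hS : ∀ t, IsQuasiautomorphism (S t)) {s : ℝ≥0}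
    (hs : 0 < s) (t : ℝ≥0) : (S s).range ≤ (S t).range := by
  have hdouble (n : ℕ) : (S s).range ≤ (S (2 ^ n * s)).range := by
    induction n with
    | zero => rw [pow_zero, one_mul]
    | succ n ih =>
      refine ih.trans ?_
      rintro _ ⟨x, rfl⟩
      obtain ⟨z, hz⟩ := (hS (2 ^ n * s)).exists_apply_apply_eq x
      rw [← S.add_apply, ← two_mul, ← mul_assoc, ← pow_succ'] at hz
      exact ⟨z, hz⟩
  obtain ⟨n, hn⟩ := pow_unbounded_of_one_lt (t / s) (one_lt_two (α := ℝ≥0))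
  exact (hdouble n).trans (S.antitone_range ((div_lt_iff₀ hs).mp hn).le)

theorem norm_apply_eq_of_isQuasiautomorphism (hS : ∀ t, IsQuasiautomorphism (S t)) (t : ℝ≥0)
    (x : X) : ‖S t x‖ = ‖S 0 x‖ := by
  have hpos (s : ℝ≥0) (hs : 0 < s) : ‖S t (S s x)‖ = ‖S s x‖ := by
    obtain ⟨z, hz⟩ := range_le_range_of_isQuasiautomorphism hS hs t ⟨x, rfl⟩
    rw [ContinuousLinearMap.coe_coe, ContinuousLinearMap.coe_coe] at hz
    rw [← hz, (hS t).norm_apply_apply]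
  have : (𝓝[>] (0 : ℝ≥0)).NeBot := inferInstance
  have hlim : Tendsto (fun s => S s x) (𝓝[>] 0) (𝓝 (S 0 x)) :=
    ((S.continuous' x).tendsto 0).mono_left nhdsWithin_le_nhds
  rw [← S.apply_zero_apply]
  exact tendsto_nhds_unique (((S t).continuous.tendsto _).comp hlim).norm
    (hlim.norm.congr' (eventually_nhdsWithin_of_forall fun s hs => (hpos s hs).symm))

/-- The semigroup `T_t E` for an idempotent strong limit point `E` of `T`. -/
def compIdempotent (T : ContractionSemigroup X) (E : X →L[ℂ] X) (hE : E ∈ T.strongLimitPoints)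
    (hidem : IsIdempotentElem E) : ContractionSemigroup X where
  toFun t := (T t).comp E
  map_add' s t := by
    change T.toFun (s + t) * E = T.toFun s * E * (T.toFun t * E)
    rw [T.map_add', mul_assoc, ← mul_assoc E, ← (commute_apply_of_mem_strongLimitPoints hE t).eq,
      mul_assoc _ E, hidem.eq]
    rfl
  norm_le_one' t := ((T t).opNorm_comp_le E).trans
    (mul_le_one₀ (T.norm_le_one' t) (norm_nonneg _) (norm_le_one_of_mem_strongLimitPoints hE))
  continuous' x := T.continuous' (E x)

/-- `S` is the quasiautomorphic part of `T`: `S_t = T_t E`, where the idempotent `E = S_0` is a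
strong limit point of `T`. For locally finite `T` this means that `S` is the asymptotic semigroup
of quasiautomorphisms, see `isQuasiautomorphicPart_iff`. -/
structure IsQuasiautomorphicPart (S T : ContractionSemigroup X) : Prop where
  zero_mem : S 0 ∈ T.strongLimitPoints
  eq_comp : ∀ t, S t = (T t).comp (S 0)

theorem isQuasiautomorphicPart_compIdempotent (hE : E ∈ T.strongLimitPoints)
    (hidem : IsIdempotentElem E) : (T.compIdempotent E hE hidem).IsQuasiautomorphicPart T := by
  have hzero : T.compIdempotent E hE hidem 0 = E :=
    ContinuousLinearMap.ext (zero_apply_of_mem_strongLimitPoints hE)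
  exact ⟨hzero.symm ▸ hE, fun t => congrArg (T t).comp hzero.symm⟩

theorem IsLocallyFinite.existsUnique_isQuasiautomorphicPart (hT : T.IsLocallyFinite) :
    ∃! S : ContractionSemigroup X, S.IsQuasiautomorphicPart T := by
  obtain ⟨E, hE, hidem⟩ := hT.exists_isIdempotentElem_mem_strongLimitPoints
  have hpart := isQuasiautomorphicPart_compIdempotent hE hidem
  refine ⟨_, hpart, fun S hS => ?_⟩
  have hzero : S 0 = T.compIdempotent E hE hidem 0 :=
    eq_of_isIdempotentElem_of_mem_strongLimitPoints hS.zero_mem hpart.zero_mem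
      S.isIdempotentElem_zero (isIdempotentElem_zero _)
  have hfun : S.toFun = (T.compIdempotent E hE hidem).toFun :=
    funext fun t => by rw [hS.eq_comp, hpart.eq_comp, hzero]
  cases S
  cases hfun
  rfl

namespace IsQuasiautomorphicPart

variable (hS : S.IsQuasiautomorphicPart T)
include hS

theorem apply_eq {x : X} (hx : S 0 x = x) (t : ℝ≥0) : S t x = T t x := by
  rw [hS.eq_comp, ContinuousLinearMap.comp_apply, hx]

theorem norm_apply {x : X} (hx : S 0 x = x) (t : ℝ≥0) : ‖S t x‖ = ‖x‖ := by
  rw [hS.apply_eq hx, norm_apply_eq_of_mem_strongLimitPoints hS.zero_mem hx]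

theorem tendsto_apply_sub (x : X) : Tendsto (fun t => T t x - S t x) atTop (𝓝 0) :=
  (tendsto_apply_sub_of_mem_strongLimitPoints hS.zero_mem S.isIdempotentElem_zero x).congr
    fun t => by rw [map_sub, ← ContinuousLinearMap.comp_apply, ← hS.eq_comp]

theorem eq_zero_iff {F : X →L[ℂ] X} : F ∈ T.strongLimitPoints ∧ IsIdempotentElem F ↔ F = S 0 := by
  refine ⟨fun hF => eq_of_isIdempotentElem_of_mem_strongLimitPoints hF.1 hS.zero_mem hF.2
    S.isIdempotentElem_zero, ?_⟩
  rintro rfl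
  exact ⟨hS.zero_mem, S.isIdempotentElem_zero⟩

theorem exists_apply_eq (hT : T.IsLocallyFinite) {x : X} (hx : S 0 x = x) (t : ℝ≥0) :
    ∃ z, S 0 z = z ∧ S t z = x := by
  obtain ⟨z, hz, hzx⟩ := hT.exists_apply_eq hS.zero_mem hx t
  exact ⟨z, hz, (hS.apply_eq hz t).trans hzx⟩

theorem isQuasiautomorphism (hT : T.IsLocallyFinite) (t : ℝ≥0) : IsQuasiautomorphism (S t) := by
  have hfix := S.zero_apply_apply t
  refine .of_norm_apply_apply (S.norm_le_one' t) (fun x => hS.norm_apply (hfix x) t) fun x => ?_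
  obtain ⟨w, hw, hwx⟩ := hS.exists_apply_eq hT (hfix x) t
  obtain ⟨z, -, hzw⟩ := hS.exists_apply_eq hT hw t
  exact ⟨z, by rw [hzw, hwx]⟩

theorem range_eq (hT : T.IsLocallyFinite) (t : ℝ≥0) : (S t).range = (S 0).range := by
  refine le_antisymm (S.antitone_range zero_le) ?_
  rintro _ ⟨x, rfl⟩
  obtain ⟨z, -, hz⟩ := hS.exists_apply_eq hT (S.zero_apply_apply 0 x) t
  exact ⟨z, hz⟩

end IsQuasiautomorphicPart

theorem isQuasiautomorphicPart_of_tendsto (hS : ∀ t, IsQuasiautomorphism (S t))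
    (hTS : ∀ x, Tendsto (fun t => T t x - S t x) atTop (𝓝 0)) (hE : E ∈ T.strongLimitPoints)
    (hidem : IsIdempotentElem E) : S.IsQuasiautomorphicPart T := by
  obtain ⟨u, hu, hTu⟩ := mem_strongLimitPoints_iff.mp hE
  have hSu (x : X) : Tendsto (fun t => S t x) u (𝓝 (E x)) := by
    simpa only [sub_sub_cancel, sub_zero] using (hTu x).sub ((hTS x).mono_left hu)
  have hES : E ∈ S.strongLimitPoints := mem_strongLimitPoints_iff.mpr ⟨u, hu, hSu⟩
  -- The commuting idempotents `S 0` and `E` both have the kernel `{x | S_t x → 0}`.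
  have hzero : S 0 = E := by
    refine eq_of_isIdempotentElem_of_commute_of_ker_eq S.isIdempotentElem_zero hidem
      (commute_apply_of_mem_strongLimitPoints hES 0) fun x => ?_
    rw [apply_eq_zero_iff_tendsto hES, tendsto_zero_iff_norm_tendsto_zero]
    simp only [norm_apply_eq_of_isQuasiautomorphism hS, tendsto_const_nhds_iff, norm_eq_zero]
  refine ⟨hzero ▸ hE, fun s => ?_⟩
  ext x
  have hadd : Tendsto (fun t : ℝ≥0 => s + t) u atTop :=
    (tendsto_atTop_mono (fun t => le_add_self) tendsto_id).mono_left hu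
  have hlim : Tendsto (fun t => T (s + t) x - S (s + t) x) u (𝓝 (T s (E x) - S s (E x))) := by
    simp only [T.add_apply, S.add_apply]
    exact (((T s).continuous.tendsto _).comp (hTu x)).sub
      (((S s).continuous.tendsto _).comp (hSu x))
  have heq : T s (E x) = S s (E x) :=
    sub_eq_zero.mp (tendsto_nhds_unique hlim ((hTS x).comp hadd))
  rw [ContinuousLinearMap.comp_apply, hzero, heq, ← hzero, S.apply_zero_apply]

theorem isQuasiautomorphicPart_iff (hT : T.IsLocallyFinite) : S.IsQuasiautomorphicPart T ↔
    (∀ t, IsQuasiautomorphism (S t)) ∧ ∀ x, Tendsto (fun t => ‖T t x - S t x‖) atTop (𝓝 0) := by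
  simp only [← tendsto_zero_iff_norm_tendsto_zero]
  refine ⟨fun hS => ⟨hS.isQuasiautomorphism hT, hS.tendsto_apply_sub⟩, fun ⟨hS, hTS⟩ => ?_⟩
  obtain ⟨E, hE, hidem⟩ := hT.exists_isIdempotentElem_mem_strongLimitPoints
  exact isQuasiautomorphicPart_of_tendsto hS hTS hE hidem

end Quasiautomorphism

end ContractionSemigroup

/-! ### Generators and eigenvectors -/

section ExponentialGrowth

theorem hasDerivAt_cexp_ofReal_mul (w : ℂ) (s : ℝ) :
    HasDerivAt (fun r : ℝ => Complex.exp (r * w)) (Complex.exp (s * w) * w) s := by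
  have hlin : HasDerivAt (fun r : ℝ => (r : ℂ) * w) w s := by
    simpa only [Complex.ofReal_one, one_mul] using (hasDerivAt_id' s).ofReal_comp.mul_const w
  exact hlin.cexp

theorem eq_exp_smul_of_hasDerivWithinAt_Ici {Y : Type*} [NormedAddCommGroup Y] [NormedSpace ℂ Y]
    {f : ℝ → Y} {w : ℂ} (hf : ContinuousOn f (Set.Ici 0))
    (hf' : ∀ s, 0 ≤ s → HasDerivWithinAt f (w • f s) (Set.Ici s) s) {t : ℝ} (ht : 0 ≤ t) :
    f t = Complex.exp (t * w) • f 0 := by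
  have hconst : Complex.exp (t * -w) • f t = Complex.exp ((0 : ℝ) * -w) • f 0 := by
    refine constant_of_has_deriv_right_zero (f := fun r : ℝ => Complex.exp (r * -w) • f r)
      (Continuous.continuousOn (by fun_prop) |>.smul (hf.mono Set.Icc_subset_Ici_self))
      (fun s hs => ((hasDerivAt_cexp_ofReal_mul (-w) s).hasDerivWithinAt.smul
        (hf' s hs.1)).congr_deriv ?_) t ⟨ht, le_rfl⟩
    rw [smul_smul, ← add_smul, ← mul_add, add_neg_cancel, mul_zero, zero_smul]
  calc f t = Complex.exp (t * w) • Complex.exp (t * -w) • f t := by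
        rw [smul_smul, ← Complex.exp_add, mul_neg, add_neg_cancel, Complex.exp_zero, one_smul]
    _ = Complex.exp (t * w) • f 0 := by
        rw [hconst, Complex.ofReal_zero, zero_mul, Complex.exp_zero, one_smul]

/-- Integrating `g (r + s) = g r * g s` over `s ∈ [0, δ]` expresses `g` through its primitive, so
that `g` is differentiable. -/
theorem exists_forall_eq_exp_of_continuous_of_map_add {g : ℝ → ℂ} (hg : Continuous g)
    (hg0 : g 0 = 1) (hadd : ∀ r s, 0 ≤ r → 0 ≤ s → g (r + s) = g r * g s) :
    ∃ w : ℂ, ∀ t : ℝ, 0 ≤ t → g t = Complex.exp (t * w) := by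
  let G : ℝ → ℂ := fun t => ∫ s in (0 : ℝ)..t, g s
  have hG (t : ℝ) : HasDerivAt G (g t) t := (hg.integral_hasStrictDerivAt 0 t).hasDerivAt
  obtain ⟨δ, hGδ, hδ⟩ : ∃ δ, G δ ≠ 0 ∧ 0 < δ := by
    have hne : ∀ᶠ t in 𝓝[>] (0 : ℝ), G t ≠ 0 :=
      ((hG 0).eventually_ne (hg0 ▸ one_ne_zero)).filter_mono (nhdsGT_le_nhdsNE 0)
    exact (hne.and self_mem_nhdsWithin).exists
  have hgG (r : ℝ) (hr : 0 ≤ r) : g r = (G (r + δ) - G r) / G δ := by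
    rw [eq_div_iff hGδ]
    calc g r * G δ = ∫ s in (0 : ℝ)..δ, g (r + s) := by
          rw [← intervalIntegral.integral_const_mul]
          refine intervalIntegral.integral_congr fun s hs => (hadd r s hr ?_).symm
          exact (Set.uIcc_of_le hδ.le ▸ hs).1
      _ = ∫ s in r..(r + δ), g s := by
          rw [intervalIntegral.integral_comp_add_left, add_zero]
      _ = G (r + δ) - G r := (intervalIntegral.integral_interval_sub_left
          (hg.intervalIntegrable _ _) (hg.intervalIntegrable _ _)).symm
  refine ⟨(g δ - 1) / G δ, fun t ht => ?_⟩
  have hderiv (s : ℝ) (hs : 0 ≤ s) :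
      HasDerivWithinAt g (((g δ - 1) / G δ) • g s) (Set.Ici s) s := by
    have hquot := ((((hG (s + δ)).comp_add_const s δ).sub (hG s)).div_const (G δ)).hasDerivWithinAt
      (s := Set.Ici s)
    refine (hquot.congr (fun r hr => hgG r (hs.trans hr)) (hgG s hs)).congr_deriv ?_
    rw [hadd s δ hs hδ.le, smul_eq_mul]
    ring
  simpa only [hg0, smul_eq_mul, mul_one] using
    eq_exp_smul_of_hasDerivWithinAt_Ici hg.continuousOn hderiv ht

end ExponentialGrowth

namespace ContractionSemigroup

variable {X : Type*} [NormedAddCommGroup X] [NormedSpace ℂ X] {T : ContractionSemigroup X}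

theorem isEigenvector_iff {x : X} {z : ℂ} : T.IsEigenvector z x ↔
    x ≠ 0 ∧ ∀ t : ℝ≥0, T t x = Complex.exp ((t : ℝ) * (Complex.I * z)) • x := by
  simp only [IsEigenvector, mul_left_comm, mul_assoc]

section Generator

theorem generator_apply_eq_iff {x y : X} (hx : x ∈ T.generator.domain) :
    T.generator ⟨x, hx⟩ = y ↔ T.HasGeneratorValue x y := by
  have h : T.HasGeneratorValue x (T.generator ⟨x, hx⟩) := Classical.choose_spec hx
  exact ⟨fun hy => hy ▸ h, fun hy => h.unique hy⟩

theorem HasGeneratorValue.mem_domain {x y : X} (h : T.HasGeneratorValue x y) :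
    x ∈ T.generator.domain := ⟨y, h⟩

theorem HasGeneratorValue.hasDerivWithinAt {x y : X} (h : T.HasGeneratorValue x y) {s : ℝ}
    (hs : 0 ≤ s) : HasDerivWithinAt (fun r : ℝ => T r.toNNReal x)
      (Complex.I • T s.toNNReal y) (Set.Ici s) s := by
  rw [← hasDerivWithinAt_Ioi_iff_Ici,
    hasDerivWithinAt_iff_tendsto_slope' Set.self_notMem_Ioi]
  have hsub : Tendsto (fun r : ℝ => (r - s).toNNReal) (𝓝[>] s) (𝓝[>] 0) := by
    refine tendsto_nhdsWithin_iff.mpr ⟨?_, ?_⟩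
    · exact (Continuous.tendsto' (by fun_prop) s 0 (by simp)).mono_left nhdsWithin_le_nhds
    · exact eventually_nhdsWithin_of_forall fun r hr => Real.toNNReal_pos.mpr (sub_pos.mpr hr)
  refine ((((T s.toNNReal).continuous.tendsto _).comp (h.comp hsub)).const_smul
    Complex.I).congr' (eventually_nhdsWithin_of_forall fun r (hr : s < r) => ?_)
  have hr0 : 0 ≤ r - s := sub_nonneg.mpr hr.le
  have hsplit : T r.toNNReal x = T s.toNNReal (T (r - s).toNNReal x) := by
    rw [← T.add_apply, ← Real.toNNReal_add hs hr0, add_sub_cancel]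
  rw [Function.comp_apply, Function.comp_apply, map_smul, map_sub, ← hsplit, smul_smul,
    Real.coe_toNNReal _ hr0, mul_inv, mul_inv_cancel_left₀ Complex.I_ne_zero, slope_def_module,
    ← Complex.coe_smul, Complex.ofReal_inv]

theorem HasGeneratorValue.isEigenvector {x : X} {z : ℂ} (hx : x ≠ 0) (hx0 : T 0 x = x)
    (h : T.HasGeneratorValue x (z • x)) : T.IsEigenvector z x := by
  refine isEigenvector_iff.mpr ⟨hx, fun t => ?_⟩
  have hcont : Continuous fun r : ℝ => T r.toNNReal x :=
    (T.continuous' x).comp continuous_real_toNNReal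
  have hsol := eq_exp_smul_of_hasDerivWithinAt_Ici (w := Complex.I * z) hcont.continuousOn
    (fun s hs => (h.hasDerivWithinAt hs).congr_deriv (by rw [map_smul, smul_smul])) t.coe_nonneg
  rwa [Real.toNNReal_coe, Real.toNNReal_zero, hx0] at hsol

theorem IsEigenvector.hasGeneratorValue {x : X} {z : ℂ} (h : T.IsEigenvector z x) :
    T.HasGeneratorValue x (z • x) := by
  have hcoe : Tendsto ((↑) : ℝ≥0 → ℝ) (𝓝[>] 0) (𝓝[≠] 0) :=
    tendsto_nhdsWithin_iff.mpr
      ⟨(NNReal.continuous_coe.tendsto' 0 0 rfl).mono_left nhdsWithin_le_nhds,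
        eventually_nhdsWithin_of_forall fun t ht => (NNReal.coe_pos.mpr ht).ne'⟩
  have hlim := (((hasDerivAt_iff_tendsto_slope.mp
    (hasDerivAt_cexp_ofReal_mul (Complex.I * z) 0)).comp hcoe).const_mul Complex.I⁻¹).smul_const x
  rw [Complex.ofReal_zero, zero_mul, Complex.exp_zero, one_mul,
    inv_mul_cancel_left₀ Complex.I_ne_zero] at hlim
  refine hlim.congr fun t => ?_
  rw [(isEigenvector_iff.mp h).2, mul_inv, mul_smul, mul_smul, Function.comp_apply,
    slope_def_module, sub_zero, Complex.ofReal_zero, zero_mul, Complex.exp_zero,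
    ← Complex.coe_smul, Complex.ofReal_inv, smul_assoc, sub_smul, one_smul]

theorem pointSpectrum_generator (hT0 : ∀ x, T 0 x = x) :
    T.generator.pointSpectrum = T.pointSpectrum := by
  ext z
  constructor
  · rintro ⟨⟨x, hx⟩, hx0, h⟩
    exact ⟨x, ((generator_apply_eq_iff hx).mp h).isEigenvector (fun h0 => hx0 (Subtype.ext h0))
      (hT0 x)⟩
  · rintro ⟨x, hx⟩
    exact ⟨⟨x, hx.hasGeneratorValue.mem_domain⟩, fun h0 => hx.1 (congrArg Subtype.val h0),
      (generator_apply_eq_iff _).mpr hx.hasGeneratorValue⟩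

theorem isDiagonalizedBy_maximalEigenvectors
    (h : (Submodule.span ℂ T.maximalEigenvectors).topologicalClosure = ⊤) :
    T.generator.IsDiagonalizedBy T.maximalEigenvectors :=
  ⟨fun _ ⟨⟨z, hz⟩, _⟩ => ⟨hz.1, hz.hasGeneratorValue.mem_domain, z,
    (generator_apply_eq_iff _).mpr hz.hasGeneratorValue⟩, h⟩

end Generator

section Eigenvectors

theorem exists_isEigenvector {x : X} (hx : x ≠ 0) (hx0 : T 0 x = x)
    (h : ∀ t, ∃ c : ℂ, T t x = c • x) : ∃ z, T.IsEigenvector z x := by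
  choose c hc using h
  have hinj : Function.Injective fun a : ℂ => a • x := smul_left_injective ℂ hx
  have hcont : Continuous c := (isClosedEmbedding_smul_left hx).continuous_iff.mpr
    ((T.continuous' x).congr hc)
  obtain ⟨w, hw⟩ := exists_forall_eq_exp_of_continuous_of_map_add
    (hcont.comp continuous_real_toNNReal)
    (hinj (by simp only [Function.comp_apply, Real.toNNReal_zero, ← hc, hx0, one_smul]))
    fun r s hr hs => hinj (by
      simp only [Function.comp_apply, Real.toNNReal_add hr hs, ← hc, T.add_apply]
      rw [hc s.toNNReal, map_smul, hc r.toNNReal, smul_smul, mul_comm])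
  refine ⟨Complex.I⁻¹ * w, isEigenvector_iff.mpr ⟨hx, fun t => ?_⟩⟩
  have hwt := hw t t.coe_nonneg
  rw [Function.comp_apply, Real.toNNReal_coe] at hwt
  rw [hc, hwt, mul_inv_cancel_left₀ Complex.I_ne_zero]

theorem IsEigenvector.norm_apply {x : X} {z : ℂ} (h : T.IsEigenvector z x) (t : ℝ≥0) :
    ‖T t x‖ = Real.exp (-(t * z.im)) * ‖x‖ := by
  rw [h.2, norm_smul, Complex.norm_exp]
  simp [Complex.mul_re, Complex.mul_im]

theorem IsEigenvector.im_eq_zero_iff {x : X} {z : ℂ} (h : T.IsEigenvector z x) :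
    z.im = 0 ↔ ∀ t, ‖T t x‖ = ‖x‖ := by
  refine ⟨fun hz t => by rw [h.norm_apply, hz, mul_zero, neg_zero, Real.exp_zero, one_mul],
    fun hz => ?_⟩
  have h1 := hz 1
  rw [h.norm_apply, mul_eq_right₀ (norm_ne_zero_iff.mpr h.1), Real.exp_eq_one_iff] at h1
  simpa only [NNReal.coe_one, one_mul, neg_eq_zero] using h1

/-- `x - E x` is an eigenvector for the same eigenvalue, so `‖T_t (x - E x)‖` is constant; but it
tends to `0`. -/
theorem IsEigenvector.apply_eq_of_mem_strongLimitPoints {E : X →L[ℂ] X} {x : X} {z : ℂ}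
    (h : T.IsEigenvector z x) (hz : z.im = 0) (hE : E ∈ T.strongLimitPoints)
    (hidem : IsIdempotentElem E) : E x = x := by
  by_contra hne
  have hsub : T.IsEigenvector z (x - E x) := ⟨sub_ne_zero.mpr (Ne.symm hne), fun t => by
    rw [map_sub, apply_comm_of_mem_strongLimitPoints hE, h.2, map_smul, smul_sub]⟩
  have hlim := (tendsto_apply_sub_of_mem_strongLimitPoints hE hidem x).norm
  simp only [hsub.im_eq_zero_iff.mp hz, norm_zero] at hlim
  exact hsub.1 (norm_eq_zero.mp (tendsto_nhds_unique tendsto_const_nhds hlim))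

end Eigenvectors

end ContractionSemigroup

/-! ### Groups of isometries with relatively compact orbits -/

section RealExtension

variable {H : Type*} [Group H]

theorem commute_map_multiplicative {M : Type*} [AddCommMonoid M] (V : Multiplicative M →* H)
    (s t : M) : Commute (V (.ofAdd s)) (V (.ofAdd t)) := by
  rw [commute_iff_eq, ← map_mul, mul_comm, map_mul]

theorem map_toNNReal_mul_inv_map_toNNReal_neg (V : Multiplicative ℝ≥0 →* H) {a : ℝ} {s t : ℝ≥0}
    (ha : a = s - t) : V (.ofAdd a.toNNReal) * (V (.ofAdd (-a).toNNReal))⁻¹ =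
      V (.ofAdd s) * (V (.ofAdd t))⁻¹ := by
  have hsum : a.toNNReal + t = s + (-a).toNNReal := by
    ext
    push_cast [Real.coe_toNNReal']
    linarith [max_zero_sub_eq_self a]
  rw [mul_inv_eq_iff_eq_mul, mul_assoc, (commute_map_multiplicative V _ _).inv_left.eq, ← mul_assoc,
    eq_mul_inv_iff_mul_eq, ← map_mul V, ← map_mul V, ← ofAdd_add, ← ofAdd_add, hsum]

/-- The extension of a one-parameter semigroup of invertible elements to a one-parameter group. -/
noncomputable def realExtension (V : Multiplicative ℝ≥0 →* H) : Multiplicative ℝ →* H :=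
  MonoidHom.mk' (fun a => V (.ofAdd a.toAdd.toNNReal) * (V (.ofAdd (-a.toAdd).toNNReal))⁻¹)
    fun a b => by
      rw [map_toNNReal_mul_inv_map_toNNReal_neg V (a := (a * b).toAdd)
        (s := a.toAdd.toNNReal + b.toAdd.toNNReal) (t := (-b.toAdd).toNNReal + (-a.toAdd).toNNReal),
        ofAdd_add, ofAdd_add, map_mul, map_mul, mul_inv_rev,
        (commute_map_multiplicative V _ _).inv_left.mul_mul_mul_comm]
      push_cast [toAdd_mul, Real.coe_toNNReal']
      linarith [max_zero_sub_eq_self a.toAdd, max_zero_sub_eq_self b.toAdd]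

theorem realExtension_ofAdd_sub (V : Multiplicative ℝ≥0 →* H) (s t : ℝ≥0) :
    realExtension V (.ofAdd (s - t : ℝ)) = V (.ofAdd s) * (V (.ofAdd t))⁻¹ :=
  map_toNNReal_mul_inv_map_toNNReal_neg V rfl

theorem realExtension_ofAdd_coe (V : Multiplicative ℝ≥0 →* H) (t : ℝ≥0) :
    realExtension V (.ofAdd (t : ℝ)) = V (.ofAdd t) := by
  simpa using realExtension_ofAdd_sub V t 0

end RealExtension

theorem totallyBounded_range_of_dist_eq {ι α β : Type*} [PseudoMetricSpace α]
    [PseudoMetricSpace β] {f : ι → α} {g : ι → β} (hf : TotallyBounded (Set.range f))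
    (h : ∀ i j, dist (g i) (g j) = dist (f i) (f j)) : TotallyBounded (Set.range g) := by
  let : PseudoMetricSpace ι := .induced f inferInstance
  have hf_iso : Isometry f := .of_dist_eq fun _ _ => rfl
  have hg_iso : Isometry g := .of_dist_eq h
  rw [← Set.image_univ]
  refine TotallyBounded.image ?_ hg_iso.uniformContinuous
  rw [← Set.preimage_range f]
  exact totallyBounded_preimage hf_iso.isUniformInducing hf

namespace ContractionSemigroup

section AutomorphismGroup

variable {Y : Type*} [NormedAddCommGroup Y] [NormedSpace ℂ Y] {U : ContractionSemigroup Y}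

theorem exists_monoidHom_linearIsometryEquiv (hiso : ∀ t y, ‖U t y‖ = ‖y‖)
    (hsurj : ∀ t, Function.Surjective (U t)) :
    ∃ V : Multiplicative ℝ≥0 →* (Y ≃ₗᵢ[ℂ] Y), ∀ t y, V (.ofAdd t) y = U t y :=
  ⟨MonoidHom.mk' (fun t => LinearIsometryEquiv.ofSurjective ⟨(U t.toAdd : Y →ₗ[ℂ] Y), hiso _⟩
    (hsurj _)) fun s t => LinearIsometryEquiv.ext (U.add_apply s.toAdd t.toAdd), fun _ _ => rfl⟩

theorem totallyBounded_range_realExtension (V : Multiplicative ℝ≥0 →* (Y ≃ₗᵢ[ℂ] Y)) {y : Y}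
    (hy : TotallyBounded (Set.range fun t => V t y)) :
    TotallyBounded (Set.range fun a => realExtension V a y) := by
  have hinv : TotallyBounded (Set.range fun t => (V t)⁻¹ y) := by
    refine totallyBounded_range_of_dist_eq hy fun s t => ?_
    have hst : V (s * t) ((V s)⁻¹ y) = V t y := by
      rw [mul_comm, map_mul]
      exact congrArg (V t) ((V s).apply_symm_apply y)
    have hts : V (s * t) ((V t)⁻¹ y) = V s y := by
      rw [map_mul]
      exact congrArg (V s) ((V t).apply_symm_apply y)
    rw [dist_comm (V s y), ← hst, ← hts, LinearIsometryEquiv.dist_map]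
  refine (hy.union hinv).subset ?_
  rintro _ ⟨a, rfl⟩
  rcases le_total 0 a.toAdd with ha | ha
  · refine .inl ⟨.ofAdd a.toAdd.toNNReal, ?_⟩
    beta_reduce
    rw [← realExtension_ofAdd_coe, Real.coe_toNNReal _ ha, ofAdd_toAdd]
  · refine .inr ⟨.ofAdd (-a.toAdd).toNNReal, ?_⟩
    beta_reduce
    rw [← realExtension_ofAdd_coe, ← map_inv, ← ofAdd_neg, Real.coe_toNNReal _ (neg_nonneg.mpr ha),
      neg_neg, ofAdd_toAdd]

theorem topologicalClosure_span_maximalEigenvectors [CompleteSpace Y]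
    (hiso : ∀ t y, ‖U t y‖ = ‖y‖) (hsurj : ∀ t, Function.Surjective (U t))
    (hU : ∀ y, TotallyBounded (Set.range fun t => U t y)) :
    (Submodule.span ℂ U.maximalEigenvectors).topologicalClosure = ⊤ := by
  obtain ⟨V, hV⟩ := exists_monoidHom_linearIsometryEquiv hiso hsurj
  refine eq_top_iff.mpr fun y _ => Submodule.topologicalClosure_mono
    (Submodule.span_le.mpr fun v hv => ?_) (mem_closure_span_commonEigenvectors_of_totallyBounded
      (realExtension V) (totallyBounded_range_realExtension V (y := y) ?_))
  · rcases eq_or_ne v 0 with rfl | hv0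
    · exact Submodule.zero_mem _
    · have hU0 : U 0 v = v := by rw [← hV, ofAdd_zero, map_one, LinearIsometryEquiv.coe_one, id]
      exact Submodule.subset_span ⟨exists_isEigenvector hv0 hU0 fun t =>
        (hv (.ofAdd (t : ℝ))).imp fun c hc => by rw [← hV, ← realExtension_ofAdd_coe, hc],
        fun t => hiso t v⟩
  · simp only [← hV] at hU
    exact hU y

end AutomorphismGroup

/-! ### The group on the range of the idempotent -/

section OnRange

variable {X : Type*} [NormedAddCommGroup X] [NormedSpace ℂ X] {T S : ContractionSemigroup X}

theorem mem_range_zero_iff {x : X} : x ∈ (S 0).range ↔ S 0 x = x :=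
  ⟨by rintro ⟨y, rfl⟩; exact S.zero_apply_apply 0 y, fun h => ⟨x, h⟩⟩

theorem zero_apply_coe (y : (S 0).range) : S 0 y = y := mem_range_zero_iff.mp y.2

theorem onRange_zero_apply (y : (S 0).range) : S.onRange 0 y = y := Subtype.ext (zero_apply_coe y)

theorem completeSpace_range_zero [CompleteSpace X] : CompleteSpace (S 0).range :=
  (ContinuousLinearMap.IsIdempotentElem.isClosed_range S.isIdempotentElem_zero).completeSpace_coe

namespace IsQuasiautomorphicPart

variable (hS : S.IsQuasiautomorphicPart T)
include hS

theorem onRange_apply (t : ℝ≥0) (y : (S 0).range) : (S.onRange t y : X) = T t y :=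
  hS.apply_eq (zero_apply_coe y) t

theorem norm_onRange_apply (t : ℝ≥0) (y : (S 0).range) : ‖S.onRange t y‖ = ‖y‖ :=
  hS.norm_apply (zero_apply_coe y) t

theorem surjective_onRange (hT : T.IsLocallyFinite) (t : ℝ≥0) :
    Function.Surjective (S.onRange t) := fun y => by
  obtain ⟨z, hz, hzy⟩ := hS.exists_apply_eq hT (zero_apply_coe y) t
  exact ⟨⟨z, mem_range_zero_iff.mpr hz⟩, Subtype.ext hzy⟩

theorem exists_linearIsometryEquiv_onRange (hT : T.IsLocallyFinite) (t : ℝ≥0) :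
    ∃ V : (S 0).range ≃ₗᵢ[ℂ] (S 0).range, ∀ y, V y = S.onRange t y := by
  obtain ⟨V, hV⟩ := exists_monoidHom_linearIsometryEquiv hS.norm_onRange_apply
    (hS.surjective_onRange hT)
  exact ⟨V (.ofAdd t), hV t⟩

theorem isDiagonalizedBy_generator_onRange [CompleteSpace X] (hT : T.IsLocallyFinite) :
    S.onRange.generator.IsDiagonalizedBy S.onRange.maximalEigenvectors := by
  have := completeSpace_range_zero (S := S)
  refine isDiagonalizedBy_maximalEigenvectors (topologicalClosure_span_maximalEigenvectors
    hS.norm_onRange_apply (hS.surjective_onRange hT) fun y => ?_)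
  refine (totallyBounded_preimage isometry_subtype_coe.isUniformInducing
    (hT y).totallyBounded).subset ?_
  rintro _ ⟨t, rfl⟩
  exact subset_closure ⟨t, (hS.onRange_apply t y).symm⟩

theorem isEigenvector_onRange_iff {z : ℂ} {y : (S 0).range} :
    S.onRange.IsEigenvector z y ↔ T.IsEigenvector z (y : X) := by
  simp only [IsEigenvector, ne_eq, ZeroMemClass.coe_eq_zero, Subtype.ext_iff, hS.onRange_apply,
    Submodule.coe_smul]

theorem mem_range_zero_of_isEigenvector {z : ℂ} {x : X} (hx : T.IsEigenvector z x)
    (hz : z.im = 0) : x ∈ (S 0).range :=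
  mem_range_zero_iff.mpr
    (hx.apply_eq_of_mem_strongLimitPoints hz hS.zero_mem S.isIdempotentElem_zero)

theorem image_maximalEigenvectors_onRange :
    Subtype.val '' S.onRange.maximalEigenvectors = T.maximalEigenvectors := by
  ext x
  constructor
  · rintro ⟨y, ⟨⟨z, hz⟩, -⟩, rfl⟩
    exact ⟨⟨z, hS.isEigenvector_onRange_iff.mp hz⟩,
      norm_apply_eq_of_mem_strongLimitPoints hS.zero_mem (zero_apply_coe y)⟩
  · rintro ⟨⟨z, hz⟩, hx⟩
    exact ⟨⟨x, hS.mem_range_zero_of_isEigenvector hz (hz.im_eq_zero_iff.mpr hx)⟩,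
      ⟨⟨z, hS.isEigenvector_onRange_iff.mpr hz⟩, fun t => hS.norm_onRange_apply t _⟩, rfl⟩

theorem pointSpectrum_onRange :
    S.onRange.pointSpectrum = T.pointSpectrum ∩ Set.range ((↑) : ℝ → ℂ) := by
  ext z
  constructor
  · rintro ⟨y, hy⟩
    have hz : z.im = 0 := hy.im_eq_zero_iff.mpr fun t => hS.norm_onRange_apply t y
    exact ⟨⟨y, hS.isEigenvector_onRange_iff.mp hy⟩, z.re, Complex.ext rfl hz.symm⟩
  · rintro ⟨⟨x, hx⟩, r, rfl⟩
    exact ⟨⟨x, hS.mem_range_zero_of_isEigenvector hx (Complex.ofReal_im r)⟩,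
      hS.isEigenvector_onRange_iff.mpr hx⟩

end IsQuasiautomorphicPart

end OnRange

end ContractionSemigroup

open ContractionSemigroup in
theorem theorem6p1_general {X : Type*} [NormedAddCommGroup X] [NormedSpace ℂ X] [CompleteSpace X]
    (T : ContractionSemigroup X) (hT : T.IsLocallyFinite) :
    (∃! S : ContractionSemigroup X, (∀ t, IsQuasiautomorphism (S t)) ∧
      ∀ x, Tendsto (fun t => ‖T t x - S t x‖) atTop (𝓝 0)) ∧
    ∀ S : ContractionSemigroup X, (∀ t, IsQuasiautomorphism (S t)) →
      (∀ x, Tendsto (fun t => ‖T t x - S t x‖) atTop (𝓝 0)) →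
      (∀ t x, S t x = S.onRange t ⟨S 0 x, x, rfl⟩) ∧
      (∀ t, (S t).range = (S 0).range) ∧
      (∀ t, ∃ V : (S 0).range ≃ₗᵢ[ℂ] (S 0).range, ∀ y, V y = S.onRange t y) ∧
      S.onRange.generator.IsDiagonalizedBy S.onRange.maximalEigenvectors ∧
      Subtype.val '' S.onRange.maximalEigenvectors = T.maximalEigenvectors ∧
      S.onRange.generator.pointSpectrum = S.onRange.pointSpectrum ∧
      S.onRange.pointSpectrum = T.pointSpectrum ∩ Set.range ((↑) : ℝ → ℂ) ∧
      (∀ F : X →L[ℂ] X, (F ∈ T.strongLimitPoints ∧ IsIdempotentElem F) ↔ F = S 0) ∧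
      (∀ t, ∀ y : (S 0).range, (S.onRange t y : X) = T t y) ∧
      ∀ t, S t = (T t).comp (S 0) := by
  simp only [← isQuasiautomorphicPart_iff hT]
  refine ⟨hT.existsUnique_isQuasiautomorphicPart, fun S hSq hTS => ?_⟩
  have hS : S.IsQuasiautomorphicPart T := (isQuasiautomorphicPart_iff hT).mpr ⟨hSq, hTS⟩
  exact ⟨fun t x => (S.apply_zero_apply t x).symm, hS.range_eq hT,
    hS.exists_linearIsometryEquiv_onRange hT, hS.isDiagonalizedBy_generator_onRange hT,
    hS.image_maximalEigenvectors_onRange, pointSpectrum_generator onRange_zero_apply,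
    hS.pointSpectrum_onRange, fun F => hS.eq_zero_iff, hS.onRange_apply, hS.eq_comp⟩

theorem theorem6p1 {X : Type*} [NormedAddCommGroup X] [NormedSpace ℂ X] [CompleteSpace X]
    (T : ContractionSemigroup X) (hT : T.IsLocallyFinite)
    (hT0 : T 0 = ContinuousLinearMap.id ℂ X) :
    -- existence and uniqueness of `S`
    (∃! S : ContractionSemigroup X, (∀ t, IsQuasiautomorphism (S t)) ∧
      ∀ x, Tendsto (fun t => ‖T t x - S t x‖) atTop (𝓝 0)) ∧
    -- the properties of this `S`, with `E = S 0` and `U = S.onRange`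
    ∀ S : ContractionSemigroup X, (∀ t, IsQuasiautomorphism (S t)) →
      (∀ x, Tendsto (fun t => ‖T t x - S t x‖) atTop (𝓝 0)) →
      -- the polar decomposition `S_t = U_t E`, with `U_t` an automorphism of `EX = S_t X`
      (∀ t x, S t x = S.onRange t ⟨S 0 x, x, rfl⟩) ∧
      (∀ t, (S t).range = (S 0).range) ∧
      (∀ t, ∃ V : (S 0).range ≃ₗᵢ[ℂ] (S 0).range, ∀ y, V y = S.onRange t y) ∧
      -- diagonalization of the generator of `U` by the maximal eigenvectors
      S.onRange.generator.IsDiagonalizedBy S.onRange.maximalEigenvectors ∧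
      Subtype.val '' S.onRange.maximalEigenvectors = T.maximalEigenvectors ∧
      -- the point spectrum
      S.onRange.generator.pointSpectrum = S.onRange.pointSpectrum ∧
      S.onRange.pointSpectrum = T.pointSpectrum ∩ Set.range ((↑) : ℝ → ℂ) ∧
      -- `E` is the unique idempotent strong limit point
      (∀ F : X →L[ℂ] X, (F ∈ T.strongLimitPoints ∧ IsIdempotentElem F) ↔ F = S 0) ∧
      -- `U_t` is the restriction of `T_t`, and `S_t = T_t E`
      (∀ t, ∀ y : (S 0).range, (S.onRange t y : X) = T t y) ∧
      ∀ t, S t = (T t).comp (S 0) :=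
  theorem6p1_general T hT
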